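/- Let $\mathbb{R}^2$ be the Euclidean plane; all compact convex sets are assumed nonempty, and all lines are directed. A line $t$ is a supporting line of a compact convex set $X$ if $t\cap X\neq\emptyset$ and $X$ lies in the closed half-plane on the left of $t$. For compact convex sets $D,L\subseteq\mathbb{R}^2$ define: - $D$ and $L$ are *old-crossing* if neither $D\setminus L$ nor $L\setminus D$ is (path-)connected, where $\emptyset$ counts as connected; - $D$ *new-crosses* $L$ if $D$ and $L$ have two distinct common (directed) supporting lines $t,t'$ such that for each $s\in\{t,t'\}$ the first point of $(D\cup L)\cap s$, with respect to the direction of $s$, lies in $D\setminus L$ and its last point lies in $L\setminus D$; - $D$ and $L$ *strongly new-cross* if $D$ new-crosses $L$ and $L$ new-crosses $D$; they *weakly new-cross* if $D$ new-crosses $L$ or $L$ new-crosses $D$. Consider the five concepts for pairs $(D,L)$: $\beta$ ("$D$ and $L$ strongly new-cross"), $\lambda$ ("$D$ new-crosses $L$"), $\rho$ ("$L$ new-crosses $D$"), $\varepsilon$ ("$D$ and $L$ weakly new-cross"), $\tau$ ("$D$ and $L$ are old-crossing"). For concepts $u,v$ let $u\le v$ mean that for all compact convex $D,L\subseteq\mathbb{R}^2$,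 if $(D,L)$ satisfies $u$ then it satisfies $v$; let $u\le_{\mathrm{rot}} v$ mean the same restricted to pairs $(D,L)$ such that $L$ is obtained from $D$ by a rotation about some point of the plane. **Theorem.** Both $\le$ and $\le_{\mathrm{rot}}$ are partial orders on the five-element set $\{\beta,\lambda,\rho,\varepsilon,\tau\}$, they are the same partial order, and the covering pairs of this order are exactly $\beta<\lambda$, $\beta<\rho$, $\lambda<\varepsilon$, $\rho<\varepsilon$ and $\varepsilon<\tau$. That is, $\beta<\lambda<\varepsilon<\tau$, $\beta<\rho<\varepsilon<\tau$, and $\lambda$ and $\rho$ are incomparable. -/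

import Mathlib

namespace CrossingHierarchy

/-- The Euclidean plane. -/
abbrev Plane : Type := EuclideanSpace ℝ (Fin 2)

/-- The cross product `u₀ v₁ - u₁ v₀`; it is nonnegative iff `v` does not point to the right
of `u` (counterclockwise is positive). -/
def cross (u v : Plane) : ℝ := u 0 * v 1 - u 1 * v 0

/-- A directed line. It is given by its direction, a unit vector `dir`, and by its signed
offset; its point set is `{Q | cross dir Q = offset}`. Every directed line has exactly one such
description, so equality of terms is equality of directed lines (the same undirected line with
the opposite direction is a different directed line). -/
@[ext]
structure DirectedLine where
  /-- the direction, a point of the unit circle -/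
  dir : Plane
  /-- the signed offset -/
  offset : ℝ
  norm_dir : ‖dir‖ = 1

/-- The set of points of a directed line. -/
def DirectedLine.points (t : DirectedLine) : Set Plane := {Q | cross t.dir Q = t.offset}

/-- The closed half-plane on the left of a directed line. -/
def DirectedLine.left (t : DirectedLine) : Set Plane := {Q | t.offset ≤ cross t.dir Q}

/-- `t` is a (directed) supporting line of `X`: it meets `X`, and `X` lies in the closed left
half-plane of `t`. -/
def IsSupportingLine (t : DirectedLine) (X : Set Plane) : Prop :=
  (t.points ∩ X).Nonempty ∧ X ⊆ t.left

/-- `U` is the first point of `S ∩ t`, in the order along `t` given by its direction. -/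
def IsFirstPoint (t : DirectedLine) (S : Set Plane) (U : Plane) : Prop :=
  U ∈ S ∩ t.points ∧ ∀ Q ∈ S ∩ t.points, inner ℝ t.dir U ≤ inner ℝ t.dir Q

/-- `U` is the last point of `S ∩ t`, in the order along `t` given by its direction. -/
def IsLastPoint (t : DirectedLine) (S : Set Plane) (U : Plane) : Prop :=
  U ∈ S ∩ t.points ∧ ∀ Q ∈ S ∩ t.points, inner ℝ t.dir Q ≤ inner ℝ t.dir U

/-- `t` is a common supporting line of `D` and `L`, the first point of `(D ∪ L) ∩ t` is in
`D \ L` and the last point of `(D ∪ L) ∩ t` is in `L \ D`. -/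
def IsCrossingLine (t : DirectedLine) (D L : Set Plane) : Prop :=
  IsSupportingLine t D ∧ IsSupportingLine t L ∧
    (∃ U, IsFirstPoint t (D ∪ L) U ∧ U ∈ D \ L) ∧
    (∃ U, IsLastPoint t (D ∪ L) U ∧ U ∈ L \ D)

/-- `D` new-crosses `L`. -/
def NewCrosses (D L : Set Plane) : Prop :=
  ∃ t t' : DirectedLine, t ≠ t' ∧ IsCrossingLine t D L ∧ IsCrossingLine t' D L

/-- Any two points of `X` are joined by a continuous curve in `X`; the empty set qualifies. -/
def Connected (X : Set Plane) : Prop :=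
  ∀ A ∈ X, ∀ B ∈ X, JoinedIn X A B

/-- `X` and `Y` are old-crossing (in the sense of Fejes-Tóth): neither `X \ Y` nor `Y \ X` is
connected. -/
def OldCrossing (X Y : Set Plane) : Prop :=
  ¬ Connected (X \ Y) ∧ ¬ Connected (Y \ X)

/-- The five labels of the crossing concepts. -/
inductive Concept
  /-- `D` and `L` strongly new-cross -/
  | strong
  /-- `D` new-crosses `L` -/
  | forward
  /-- `L` new-crosses `D` -/
  | backward
  /-- `D` and `L` weakly new-cross -/
  | weak
  /-- `D` and `L` are old-crossing -/
  | old

/-- `D` crosses `L` in the sense of the given concept. -/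
def Crosses : Concept → Set Plane → Set Plane → Prop
  | .strong, D, L => NewCrosses D L ∧ NewCrosses L D
  | .forward, D, L => NewCrosses D L
  | .backward, D, L => NewCrosses L D
  | .weak, D, L => NewCrosses D L ∨ NewCrosses L D
  | .old, D, L => OldCrossing D L

/-- The rotation of the plane by the angle `θ` (counterclockwise) about the point `C`. -/
noncomputable def rotation (C : Plane) (θ : ℝ) (P : Plane) : Plane :=
  !₂[C 0 + Real.cos θ * (P 0 - C 0) - Real.sin θ * (P 1 - C 1),
     C 1 + Real.sin θ * (P 0 - C 0) + Real.cos θ * (P 1 - C 1)]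

/-- `Y` is obtained from `X` by a rotation about some point. -/
def IsRotatedCopy (X Y : Set Plane) : Prop :=
  ∃ (C : Plane) (θ : ℝ), Y = rotation C θ '' X

/-- `u ≤ v`: for all nonempty compact convex sets `D` and `L` in the plane, if `D` crosses `L`
in the sense of `u`, then also in the sense of `v`. -/
def Implies (u v : Concept) : Prop :=
  ∀ D L : ConvexBody Plane, Crosses u D L → Crosses v D L

/-- `u ≤_rot v`: the same, but only for pairs such that `L` is obtained from `D` by a
rotation. -/
def ImpliesRot (u v : Concept) : Prop :=
  ∀ D L : ConvexBody Plane, IsRotatedCopy (D : Set Plane) L → Crosses u D L → Crosses v D L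

/-- `b` covers `a` with respect to the partial order `r`. -/
def Covers {α : Type*} (r : α → α → Prop) (a b : α) : Prop :=
  r a b ∧ a ≠ b ∧ ∀ c, r a c → r c b → c = a ∨ c = b

/-- The edges of the diagram, from the lower end to the upper end. -/
inductive HasseEdge : Concept → Concept → Prop
  | strong_forward : HasseEdge .strong .forward
  | strong_backward : HasseEdge .strong .backward
  | forward_weak : HasseEdge .forward .weak
  | backward_weak : HasseEdge .backward .weak
  | weak_old : HasseEdge .weak .old

end CrossingHierarchy

namespace CrossingHierarchy

/-! The only deep implication is that weak new-crossing gives old-crossing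
(`NewCrosses.oldCrossing`). Let two crossing lines have first points U, U' in D \ L and last points
V, V' in L \ D. The chord VV' lies in L, and since D is left of both lines, D meets the line VV'
only inside this chord. So the line VV' misses D \ L, while U and U' lie on opposite sides of it.
The chord UU' of D cuts L \ D in the same way. All other non-implications follow from two pairs of
rotated polygons. Two congruent rectangles with a common diagonal (`rect_newCrosses`,
`rect_not_newCrosses`) new-cross in one order only; two hexagons (`hex_oldCrossing`, `hex_tips`) are
old-crossing but not weakly new-crossing. As both pairs are rotated copies, the two orders coincide.
-/

/-! ### Coordinates on directed lines -/

lemma cross_sub (u v w : Plane) : cross u (v - w) = cross u v - cross u w := by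
  simp [cross]; ring

lemma inner_eq_coord (u v : Plane) : inner ℝ u v = u 0 * v 0 + u 1 * v 1 := by
  simp [PiLp.inner_apply, Fin.sum_univ_two, mul_comm]

lemma DirectedLine.sq_add_sq (t : DirectedLine) : t.dir 0 ^ 2 + t.dir 1 ^ 2 = 1 := by
  have h := EuclideanSpace.norm_sq_eq t.dir
  rw [t.norm_dir] at h
  simpa [Fin.sum_univ_two] using h.symm

/-- A point of a directed line is determined by its position along the line. -/
lemma DirectedLine.exists_smul {t : DirectedLine} {P Q : Plane} (hP : P ∈ t.points)
    (hQ : Q ∈ t.points) :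
    Q = P + (inner ℝ t.dir Q - inner ℝ t.dir P) • t.dir := by
  have h := t.sq_add_sq
  simp only [points, Set.mem_ofPred_eq, cross] at hP hQ
  ext i
  simp only [inner_eq_coord]
  fin_cases i
  · simp
    linear_combination (-(Q 0) + P 0) * h - t.dir 1 * (hQ - hP)
  · simp
    linear_combination (-(Q 1) + P 1) * h + t.dir 0 * (hQ - hP)

lemma cross_smul (u v : Plane) (a : ℝ) : cross u (a • v) = a * cross u v := by
  simp [cross]; ring

lemma cross_add (u v w : Plane) : cross u (v + w) = cross u v + cross u w := by
  simp [cross]; ring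

lemma cross_swap (u v : Plane) : cross u v = -cross v u := by
  simp [cross, mul_comm]

lemma continuous_cross (u : Plane) : Continuous (cross u) := by
  unfold cross; fun_prop

/-! ### New-crossing implies old-crossing -/

/-- Endpoints of a crossing line, with the position of the last point relative to the first. -/
lemma IsCrossingLine.exists_endpoints {t : DirectedLine} {D L : Set Plane}
    (h : IsCrossingLine t D L) :
    ∃ U V : Plane, ∃ a : ℝ, U ∈ D \ L ∧ V ∈ L \ D ∧ 0 < a ∧ V = U + a • t.dir ∧
      D ∪ L ⊆ t.left ∧ U ∈ t.points ∧ V ∈ t.points ∧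
      IsFirstPoint t (D ∪ L) U ∧ IsLastPoint t (D ∪ L) V := by
  obtain ⟨hD, hL, ⟨U, hU, hUm⟩, V, hV, hVm⟩ := h
  have e := DirectedLine.exists_smul hU.1.2 hV.1.2
  refine ⟨U, V, _, hUm, hVm, ?_, e, Set.union_subset hD.2 hL.2, hU.1.2, hV.1.2, hU, hV⟩
  refine lt_of_le_of_ne (sub_nonneg.2 (hU.2 V hV.1)) fun h0 => hUm.2 ?_
  rw [← h0, zero_smul, add_zero] at e
  exact e ▸ hVm.1

/-- Parallel or antiparallel unit directions. -/
lemma DirectedLine.dir_eq_or_neg {t t' : DirectedLine} (h : cross t.dir t'.dir = 0) :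
    t'.dir = t.dir ∨ t'.dir = -t.dir := by
  have h1 := t.sq_add_sq
  have h2 := t'.sq_add_sq
  simp only [cross] at h
  set c := t.dir 0 * t'.dir 0 + t.dir 1 * t'.dir 1 with hc
  have e0 : t'.dir 0 = c * t.dir 0 := by
    rw [hc]; linear_combination (-(t'.dir 0)) * h1 - t.dir 1 * h
  have e1 : t'.dir 1 = c * t.dir 1 := by
    rw [hc]; linear_combination (-(t'.dir 1)) * h1 + t.dir 0 * h
  have hc2 : (c - 1) * (c + 1) = 0 := by
    rw [e0, e1] at h2; linear_combination h2 - c ^ 2 * h1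
  rcases mul_eq_zero.1 hc2 with h3 | h3
  · left
    have : c = 1 := by linarith
    ext i; fin_cases i <;> simp [e0, e1, this]
  · right
    have : c = -1 := by linarith
    ext i; fin_cases i <;> simp [e0, e1, this]

/-- Two distinct lines that both carry a transition from `D` to `L` cannot be parallel when they
share a point. -/
lemma IsCrossingLine.cross_dir_ne_zero {t t' : DirectedLine} {D L : Set Plane} (hne : t ≠ t')
    (h : IsCrossingLine t D L) (h' : IsCrossingLine t' D L) {P : Plane} (hP : P ∈ t.points)
    (hP' : P ∈ t'.points) : cross t.dir t'.dir ≠ 0 := by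
  intro h0
  obtain ⟨U, V, a, hU, hV, ha, -, -, hUt, hVt, hfU, hlV⟩ := h.exists_endpoints
  obtain ⟨U', V', a', hU', hV', ha', -, -, hUt', hVt', hfU', hlV'⟩ := h'.exists_endpoints
  simp only [DirectedLine.points, Set.mem_ofPred_eq] at hP hP'
  rcases DirectedLine.dir_eq_or_neg h0 with e | e
  · exact hne (DirectedLine.ext e.symm (by rw [← hP, ← hP', e]))
  -- Same point set, opposite directions: the last point `V` on `t` is then the first point `U'` on
  -- `t'`, but `V` is not in `D`.
  · have ho : t'.offset = -t.offset := by rw [← hP, ← hP', e]; simp [cross]; ring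
    have hpts : t'.points = t.points := by
      ext Q
      simp only [DirectedLine.points, Set.mem_ofPred_eq, e, ho]
      constructor <;> intro hQ <;> simp [cross] at hQ ⊢ <;> linarith
    have h1 := hlV.2 U' ⟨Or.inl hU'.1, hpts ▸ hUt'⟩
    have h2 := hfU'.2 V ⟨Or.inr hV.1, hpts ▸ hVt⟩
    rw [e, inner_neg_left, inner_neg_left] at h2
    have h3 := DirectedLine.exists_smul hVt (hpts ▸ hUt' : U' ∈ t.points)
    rw [show inner ℝ t.dir U' - inner ℝ t.dir V = 0 by linarith] at h3
    simp at h3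
    exact hV.2 (h3 ▸ hU'.1)

/-- The last point on a crossing line is not on another crossing line. -/
lemma last_notMem_points {t t' : DirectedLine} {D L : Set Plane} (hne : t ≠ t')
    (h : IsCrossingLine t D L) (h' : IsCrossingLine t' D L) {V : Plane} (hV : V ∈ L)
    (hl : IsLastPoint t' (D ∪ L) V) : V ∉ t.points := by
  intro hVt
  have hs := h.cross_dir_ne_zero hne h' hVt hl.1.2
  obtain ⟨U₁, V₁, a₁, hU₁, -, -, -, hsub₁, hUt₁, -, hf₁, -⟩ := h.exists_endpoints
  obtain ⟨U₂, V₂, a₂, hU₂, -, -, -, hsub₂, hUt₂, -, hf₂, -⟩ := h'.exists_endpoints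
  have e₁ := DirectedLine.exists_smul hUt₁ hVt
  have e₂ := DirectedLine.exists_smul hUt₂ hl.1.2
  have p₁ : 0 < inner ℝ t.dir V - inner ℝ t.dir U₁ :=
    lt_of_le_of_ne (sub_nonneg.2 (hf₁.2 V ⟨Or.inr hV, hVt⟩)) fun h0 => hU₁.2 (by
      rw [← h0] at e₁; simp at e₁; rwa [← e₁])
  have p₂ : 0 < inner ℝ t'.dir V - inner ℝ t'.dir U₂ :=
    lt_of_le_of_ne (sub_nonneg.2 (hf₂.2 V hl.1)) fun h0 => hU₂.2 (by
      rw [← h0] at e₂; simp at e₂; rwa [← e₂])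
  set b₁ := inner ℝ t.dir V - inner ℝ t.dir U₁
  set b₂ := inner ℝ t'.dir V - inner ℝ t'.dir U₂
  -- Each first point lies behind `V` on its own line and left of the other line; the two conditions
  -- force opposite weak signs on `cross t.dir t'.dir`.
  have q₁ : t'.offset ≤ cross t'.dir U₁ := hsub₂ (Or.inl hU₁.1)
  have q₂ : t.offset ≤ cross t.dir U₂ := hsub₁ (Or.inl hU₂.1)
  have r₁ : cross t.dir V = t.offset := hVt
  have r₂ : cross t'.dir V = t'.offset := hl.1.2
  have s₁ := congrArg (cross t'.dir) e₁
  have s₂ := congrArg (cross t.dir) e₂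
  rw [cross_add, cross_smul] at s₁ s₂
  rw [cross_swap t'.dir t.dir] at s₁
  have k₁ : 0 ≤ b₁ * cross t.dir t'.dir := by linarith
  have k₂ : b₂ * cross t.dir t'.dir ≤ 0 := by linarith
  exact hs (le_antisymm (nonpos_of_mul_nonpos_right k₂ p₂) (nonneg_of_mul_nonneg_right k₁ p₁))

/-- The first point on a crossing line is not on another crossing line. -/
lemma first_notMem_points {t t' : DirectedLine} {D L : Set Plane} (hne : t ≠ t')
    (h : IsCrossingLine t D L) (h' : IsCrossingLine t' D L) {U : Plane} (hU : U ∈ D)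
    (hf : IsFirstPoint t' (D ∪ L) U) : U ∉ t.points := by
  intro hUt
  have hs := h.cross_dir_ne_zero hne h' hUt hf.1.2
  obtain ⟨U₁, V₁, a₁, -, hV₁, -, -, hsub₁, -, hVt₁, -, hl₁⟩ := h.exists_endpoints
  obtain ⟨U₂, V₂, a₂, -, hV₂, -, -, hsub₂, -, hVt₂, -, hl₂⟩ := h'.exists_endpoints
  have e₁ := DirectedLine.exists_smul hUt hVt₁
  have e₂ := DirectedLine.exists_smul hf.1.2 hVt₂
  have p₁ : 0 < inner ℝ t.dir V₁ - inner ℝ t.dir U :=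
    lt_of_le_of_ne (sub_nonneg.2 (hl₁.2 U ⟨Or.inl hU, hUt⟩)) fun h0 => hV₁.2 (by
      rw [← h0] at e₁; simp at e₁; rwa [e₁])
  have p₂ : 0 < inner ℝ t'.dir V₂ - inner ℝ t'.dir U :=
    lt_of_le_of_ne (sub_nonneg.2 (hl₂.2 U hf.1)) fun h0 => hV₂.2 (by
      rw [← h0] at e₂; simp at e₂; rwa [e₂])
  set b₁ := inner ℝ t.dir V₁ - inner ℝ t.dir U
  set b₂ := inner ℝ t'.dir V₂ - inner ℝ t'.dir U
  -- The last points lie ahead of the common point `U`, so both signs are reversed and still clash.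
  have q₁ : t'.offset ≤ cross t'.dir V₁ := hsub₂ (Or.inr hV₁.1)
  have q₂ : t.offset ≤ cross t.dir V₂ := hsub₁ (Or.inr hV₂.1)
  have r₁ : cross t.dir U = t.offset := hUt
  have r₂ : cross t'.dir U = t'.offset := hf.1.2
  have s₁ := congrArg (cross t'.dir) e₁
  have s₂ := congrArg (cross t.dir) e₂
  rw [cross_add, cross_smul] at s₁ s₂
  rw [cross_swap t'.dir t.dir] at s₁
  have k₁ : b₁ * cross t.dir t'.dir ≤ 0 := by linarith
  have k₂ : 0 ≤ b₂ * cross t.dir t'.dir := by linarith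
  exact hs (le_antisymm (nonpos_of_mul_nonpos_right k₁ p₁) (nonneg_of_mul_nonneg_right k₂ p₂))

/-- A continuous functional that vanishes nowhere on a connected set has constant sign there. -/
lemma Connected.not_of_sign_change {X : Set Plane} {f : Plane → ℝ} (hf : Continuous f)
    (h0 : ∀ Q ∈ X, f Q ≠ 0) {A B : Plane} (hA : A ∈ X) (hB : B ∈ X) (hneg : f A < 0)
    (hpos : 0 < f B) : ¬ Connected X := by
  intro hX
  obtain ⟨γ, hγ⟩ := hX A hA B hB
  have hc : Continuous fun s => f (γ s) := hf.comp γ.continuous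
  obtain ⟨s, hs⟩ := mem_range_of_exists_le_of_exists_ge hc (c := 0)
    ⟨0, by simpa using hneg.le⟩ ⟨1, by simpa using hpos.le⟩
  exact h0 _ (hγ s) hs

/-- A chord `VV'` of the convex set `L` joining two supporting lines of `D` cuts `D \ L` between
points of the supporting lines which are on the same side of `V` and `V'` respectively. -/
lemma not_connected_diff_of_chord {D L : Set Plane} (hL : Convex ℝ L) {U U' V V' d d' : Plane}
    {a a' : ℝ} (hU : U ∈ D \ L) (hU' : U' ∈ D \ L) (hV : V ∈ L) (hV' : V' ∈ L)
    (hD : ∀ Q ∈ D, 0 ≤ cross d (Q - V)) (hD' : ∀ Q ∈ D, 0 ≤ cross d' (Q - V'))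
    (hpos : 0 < cross d (V' - V)) (hpos' : 0 < cross d' (V - V'))
    (hUV : U = V + a • d) (hUV' : U' = V' + a' • d') (haa : 0 < a * a') :
    ¬ Connected (D \ L) := by
  have hcont : Continuous fun Q : Plane => cross (V' - V) (Q - V) :=
    (continuous_cross _).comp (continuous_id.sub continuous_const)
  -- If `Q` in `D` is on the line `VV'`, then its parameter `s` satisfies `0 ≤ s` by the first
  -- supporting line and `s ≤ 1` by the second, so `Q` is on the chord and hence in `L`.
  have hne : ∀ Q ∈ D \ L, cross (V' - V) (Q - V) ≠ 0 := by
    intro Q hQ h0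
    apply hQ.2
    have k := hD Q hQ.1
    have k' := hD' Q hQ.1
    set g := cross d (V' - V)
    set s := cross d (Q - V) / g
    have hs0 : 0 ≤ s := div_nonneg k hpos.le
    have hsg : s * g = cross d (Q - V) := div_mul_cancel₀ _ hpos.ne'
    have eQ : Q = V + s • (V' - V) := by
      have hg : g = d 0 * (V' 1 - V 1) - d 1 * (V' 0 - V 0) := by simp [g, cross]
      simp only [cross, PiLp.sub_apply] at hsg h0
      ext i
      fin_cases i
      · simp
        apply mul_left_cancel₀ hpos.ne'
        linear_combination (-(V' 0 - V 0)) * hsg + (Q 0 - V 0) * hg - d 0 * h0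
      · simp
        apply mul_left_cancel₀ hpos.ne'
        linear_combination (-(V' 1 - V 1)) * hsg + (Q 1 - V 1) * hg - d 1 * h0
    have hs1 : s ≤ 1 := by
      have : cross d' (Q - V') = (1 - s) * cross d' (V - V') := by
        rw [eQ]; simp [cross]; ring
      rw [this] at k'
      linarith [nonneg_of_mul_nonneg_left k' hpos']
    rw [eQ]
    exact hL.add_smul_sub_mem hV hV' ⟨hs0, hs1⟩
  have e : cross (V' - V) (U - V) = -a * cross d (V' - V) := by
    rw [hUV]; simp [cross]; ring
  have e' : cross (V' - V) (U' - V) = a' * cross d' (V - V') := by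
    rw [hUV']; simp [cross]; ring
  rcases pos_and_pos_or_neg_and_neg_of_mul_pos haa with ⟨h1, h2⟩ | ⟨h1, h2⟩
  · refine Connected.not_of_sign_change hcont hne hU hU' ?_ ?_
    · simp only [e]; nlinarith
    · simp only [e']; positivity
  · refine Connected.not_of_sign_change hcont hne hU' hU ?_ ?_
    · simp only [e']; nlinarith
    · simp only [e]; nlinarith

/-- One chord argument serves both halves: last points span a chord of `L` with the first points
behind them (negative parameters), first points span a chord of `D` with the last points ahead
(positive parameters). -/
lemma NewCrosses.oldCrossing {D L : Set Plane} (hD : Convex ℝ D) (hL : Convex ℝ L)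
    (h : NewCrosses D L) : OldCrossing D L := by
  obtain ⟨t, t', hne, h, h'⟩ := h
  obtain ⟨U, V, a, hU, hV, ha, e, hsub, hUt, hVt, hf, hl⟩ := h.exists_endpoints
  obtain ⟨U', V', a', hU', hV', ha', e', hsub', hUt', hVt', hf', hl'⟩ := h'.exists_endpoints
  have key : ∀ {s : DirectedLine} {P : Plane}, D ∪ L ⊆ s.left → P ∈ s.points →
      ∀ Q ∈ D ∪ L, 0 ≤ cross s.dir (Q - P) := by
    intro s P hs hP Q hQ
    rw [cross_sub, (hP : cross s.dir P = s.offset)]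
    exact sub_nonneg.2 (hs hQ)
  have key' : ∀ {s : DirectedLine} {P Q : Plane}, D ∪ L ⊆ s.left → P ∈ s.points →
      Q ∈ D ∪ L → Q ∉ s.points → 0 < cross s.dir (Q - P) := by
    intro s P Q hs hP hQ hn
    refine lt_of_le_of_ne (key hs hP Q hQ) fun h0 => hn ?_
    rw [cross_sub, (hP : cross s.dir P = s.offset)] at h0
    exact (sub_eq_zero.1 h0.symm)
  constructor
  · refine not_connected_diff_of_chord (a := -a) (a' := -a') hL hU hU' hV.1 hV'.1
      (fun Q hQ => key hsub hVt Q (Or.inl hQ)) (fun Q hQ => key hsub' hVt' Q (Or.inl hQ))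
      (key' hsub hVt (Or.inr hV'.1) (last_notMem_points hne h h' hV'.1 hl'))
      (key' hsub' hVt' (Or.inr hV.1) (last_notMem_points hne.symm h' h hV.1 hl)) ?_ ?_ ?_
    · rw [e]; simp
    · rw [e']; simp
    · simpa using mul_pos ha ha'
  · exact not_connected_diff_of_chord hD hV hV' hU.1 hU'.1
      (fun Q hQ => key hsub hUt Q (Or.inr hQ)) (fun Q hQ => key hsub' hUt' Q (Or.inr hQ))
      (key' hsub hUt (Or.inl hU'.1) (first_notMem_points hne h h' hU'.1 hf'))
      (key' hsub' hUt' (Or.inl hU.1) (first_notMem_points hne.symm h' h hU.1 hf)) e e'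
      (mul_pos ha ha')

/-! ### Polygons, rotations and vertices on supporting lines -/

/-- The convex hull of a nonempty finite set as a convex body. -/
def polygon (S : Set Plane) (hS : S.Finite) (hne : S.Nonempty) : ConvexBody Plane where
  carrier := convexHull ℝ S
  convex' := convex_convexHull ℝ S
  isCompact' := hS.isCompact_convexHull ℝ
  nonempty' := convexHull_nonempty_iff.2 hne

lemma isLinearMap_rotation_zero (θ : ℝ) : IsLinearMap ℝ (rotation 0 θ) where
  map_add x y := by ext i; fin_cases i <;> simp [rotation] <;> ring
  map_smul c x := by ext i; fin_cases i <;> simp [rotation] <;> ring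

lemma IsRotatedCopy.symm {X Y : Set Plane} (h : IsRotatedCopy X Y) : IsRotatedCopy Y X := by
  obtain ⟨C, θ, rfl⟩ := h
  refine ⟨C, -θ, ?_⟩
  have : ∀ P, rotation C (-θ) (rotation C θ P) = P := by
    intro P
    have h := Real.sin_sq_add_cos_sq θ
    ext i
    fin_cases i <;> simp [rotation]
    · linear_combination (P 0 - C 0) * h
    · linear_combination (P 1 - C 1) * h
  simp [Set.image_image, this]

/-- A point outside the convex set `K` where a supporting line touches the convex hull of `S`
witnesses a vertex outside `K` on that line. -/
lemma exists_vertex_notMem {t : DirectedLine} {S K : Set Plane} (hK : Convex ℝ K)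
    (ht : convexHull ℝ S ⊆ t.left) {Q : Plane} (hQ : Q ∈ convexHull ℝ S) (hQt : Q ∈ t.points)
    (hQK : Q ∉ K) : ∃ P ∈ S, P ∉ K ∧ P ∈ t.points := by
  by_contra! hcon
  -- An open half-plane together with a convex part of its boundary line is convex: a proper convex
  -- combination reaches the boundary only if both ends do.
  have hconv : Convex ℝ {R : Plane | R ∈ t.left ∧ (R ∈ t.points → R ∈ K)} := by
    rintro x ⟨hx, hxK⟩ y ⟨hy, hyK⟩ a b ha hb hab
    simp only [DirectedLine.left, DirectedLine.points, Set.mem_ofPred_eq, cross_add,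
      cross_smul] at hx hy hxK hyK ⊢
    have ka := mul_nonneg ha (sub_nonneg.2 hx)
    have kb := mul_nonneg hb (sub_nonneg.2 hy)
    have e : a * (cross t.dir x - t.offset) + b * (cross t.dir y - t.offset) =
        a * cross t.dir x + b * cross t.dir y - t.offset := by
      linear_combination (-t.offset) * hab
    refine ⟨by linarith, fun he => ?_⟩
    rcases ha.eq_or_lt with rfl | ha
    · obtain rfl : b = 1 := by linarith
      simpa using hyK (by linarith)
    rcases hb.eq_or_lt with rfl | hb
    · obtain rfl : a = 1 := by linarith
      simpa using hxK (by linarith)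
    · refine hK (hxK ?_) (hyK ?_) ha.le hb.le hab
      · have : a * (cross t.dir x - t.offset) = 0 := by linarith
        exact sub_eq_zero.1 ((mul_eq_zero.1 this).resolve_left ha.ne')
      · have : b * (cross t.dir y - t.offset) = 0 := by linarith
        exact sub_eq_zero.1 ((mul_eq_zero.1 this).resolve_left hb.ne')
  have hsub : convexHull ℝ S ⊆ {R : Plane | R ∈ t.left ∧ (R ∈ t.points → R ∈ K)} :=
    convexHull_min (fun P hP => ⟨ht (subset_convexHull ℝ S hP),
      fun h => by_contra fun hn => hcon P hP hn h⟩) hconv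
  exact hQK ((hsub hQ).2 hQt)

/-- This leaves finitely many candidates for crossing lines of two polygons: they pass through a
vertex of each lying outside the other. -/
lemma IsCrossingLine.exists_vertices {t : DirectedLine} {S T : Set Plane}
    (h : IsCrossingLine t (convexHull ℝ S) (convexHull ℝ T)) :
    (∃ P ∈ S, P ∉ convexHull ℝ T ∧ P ∈ t.points) ∧
      ∃ P ∈ T, P ∉ convexHull ℝ S ∧ P ∈ t.points := by
  obtain ⟨hS, hT, ⟨U, hU, hUm⟩, V, hV, hVm⟩ := h
  exact ⟨exists_vertex_notMem (convex_convexHull ℝ T) hS.2 hUm.1 hU.1.2 hUm.2,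
    exists_vertex_notMem (convex_convexHull ℝ S) hT.2 hVm.1 hV.1.2 hVm.2⟩

/-- Linear inequalities pass from a set to its convex hull. -/
lemma le_of_mem_convexHull {S : Set Plane} {p q c : ℝ} (h : ∀ P ∈ S, p * P 0 + q * P 1 ≤ c)
    {Q : Plane} (hQ : Q ∈ convexHull ℝ S) : p * Q 0 + q * Q 1 ≤ c := by
  refine convexHull_min (t := {Q : Plane | p * Q 0 + q * Q 1 ≤ c}) h ?_ hQ
  intro x hx y hy a b ha hb hab
  simp only [Set.mem_ofPred_eq, PiLp.add_apply, PiLp.smul_apply, smul_eq_mul] at hx hy ⊢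
  nlinarith [mul_le_mul_of_nonneg_left hx ha, mul_le_mul_of_nonneg_left hy hb,
    congrArg (· * c) hab]

/-! ### Rectangles that new-cross in one order only -/

/-- The vertices of a rectangle inscribed in the circle of radius `5`. -/
def rectVertices : Set Plane := {!₂[5, 0], !₂[3, 4], !₂[-5, 0], !₂[-3, -4]}

/-- The vertices of the mirror image of the rectangle with vertices `rectVertices`, sharing a
diagonal with it. -/
def rectVertices' : Set Plane := {!₂[5, 0], !₂[-3, 4], !₂[-5, 0], !₂[3, -4]}

lemma rect_bounds {Q : Plane} (hQ : Q ∈ convexHull ℝ rectVertices) :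
    2 * Q 0 + Q 1 ≤ 10 ∧ -10 ≤ 2 * Q 0 + Q 1 ∧ Q 0 - 2 * Q 1 ≤ 5 ∧ -5 ≤ Q 0 - 2 * Q 1 := by
  have h1 := le_of_mem_convexHull (p := 2) (q := 1) (c := 10)
    (by simp [rectVertices]; norm_num) hQ
  have h2 := le_of_mem_convexHull (p := -2) (q := -1) (c := 10)
    (by simp [rectVertices]; norm_num) hQ
  have h3 := le_of_mem_convexHull (p := 1) (q := -2) (c := 5)
    (by simp [rectVertices]; norm_num) hQ
  have h4 := le_of_mem_convexHull (p := -1) (q := 2) (c := 5)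
    (by simp [rectVertices]; norm_num) hQ
  refine ⟨?_, ?_, ?_, ?_⟩ <;> linarith

lemma rect_bounds' {Q : Plane} (hQ : Q ∈ convexHull ℝ rectVertices') :
    2 * Q 0 - Q 1 ≤ 10 ∧ -10 ≤ 2 * Q 0 - Q 1 ∧ Q 0 + 2 * Q 1 ≤ 5 ∧ -5 ≤ Q 0 + 2 * Q 1 := by
  have h1 := le_of_mem_convexHull (p := 2) (q := -1) (c := 10)
    (by simp [rectVertices']; norm_num) hQ
  have h2 := le_of_mem_convexHull (p := -2) (q := 1) (c := 10)
    (by simp [rectVertices']; norm_num) hQ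
  have h3 := le_of_mem_convexHull (p := 1) (q := 2) (c := 5)
    (by simp [rectVertices']; norm_num) hQ
  have h4 := le_of_mem_convexHull (p := -1) (q := -2) (c := 5)
    (by simp [rectVertices']; norm_num) hQ
  refine ⟨?_, ?_, ?_, ?_⟩ <;> linarith

/-- The rotation about the centre takes (3, 4) to (5, 0) and (5, 0) to (3, -4), whence the angle
with cosine 3/5. -/
lemma rect_isRotatedCopy :
    IsRotatedCopy (convexHull ℝ rectVertices) (convexHull ℝ rectVertices') := by
  refine ⟨0, -Real.arccos (3 / 5), ?_⟩
  have hc : Real.cos (Real.arccos (3 / 5)) = 3 / 5 := Real.cos_arccos (by norm_num) (by norm_num)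
  have hs : Real.sin (Real.arccos (3 / 5)) = 4 / 5 := by
    rw [Real.sin_arccos, show (1 : ℝ) - (3 / 5) ^ 2 = (4 / 5) ^ 2 by norm_num,
      Real.sqrt_sq (by norm_num)]
  rw [(isLinearMap_rotation_zero _).image_convexHull]
  congr 1
  simp only [rectVertices, rectVertices', Set.image_insert_eq, Set.image_singleton, rotation,
    Real.cos_neg, Real.sin_neg, hc, hs]
  norm_num
  ext Q
  simp only [Set.mem_insert_iff, Set.mem_singleton_iff]
  tauto

/-- The horizontal line at height `-4`, directed to the right. -/
def bottomLine : DirectedLine := ⟨!₂[1, 0], -4, by simp [EuclideanSpace.norm_eq]⟩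

/-- The horizontal line at height `4`, directed to the left. -/
def topLine : DirectedLine := ⟨!₂[-1, 0], -4, by simp [EuclideanSpace.norm_eq]⟩

lemma rect_newCrosses : NewCrosses (convexHull ℝ rectVertices) (convexHull ℝ rectVertices') := by
  have m1 : !₂[3, 4] ∈ convexHull ℝ rectVertices :=
    subset_convexHull ℝ _ (by simp [rectVertices])
  have m2 : !₂[-3, -4] ∈ convexHull ℝ rectVertices :=
    subset_convexHull ℝ _ (by simp [rectVertices])
  have m3 : !₂[-3, 4] ∈ convexHull ℝ rectVertices' :=
    subset_convexHull ℝ _ (by simp [rectVertices'])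
  have m4 : !₂[3, -4] ∈ convexHull ℝ rectVertices' :=
    subset_convexHull ℝ _ (by simp [rectVertices'])
  refine ⟨bottomLine, topLine, ?_, ⟨⟨?_, ?_⟩, ⟨?_, ?_⟩, ⟨!₂[-3, -4], ⟨?_, ?_⟩, m2, ?_⟩,
    ⟨!₂[3, -4], ⟨?_, ?_⟩, m4, ?_⟩⟩, ⟨⟨?_, ?_⟩, ⟨?_, ?_⟩, ⟨!₂[3, 4], ⟨?_, ?_⟩, m1, ?_⟩,
    ⟨!₂[-3, 4], ⟨?_, ?_⟩, m3, ?_⟩⟩⟩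
  · intro h
    have := congrArg (fun t : DirectedLine => t.dir 0) h
    norm_num [bottomLine, topLine] at this
  · exact ⟨_, by simp [DirectedLine.points, bottomLine, cross], m2⟩
  · intro Q hQ
    have := rect_bounds hQ
    simp [DirectedLine.left, bottomLine, cross]; linarith
  · exact ⟨_, by simp [DirectedLine.points, bottomLine, cross], m4⟩
  · intro Q hQ
    have := rect_bounds' hQ
    simp [DirectedLine.left, bottomLine, cross]; linarith
  · exact ⟨Or.inl m2, by simp [DirectedLine.points, bottomLine, cross]⟩
  · rintro Q ⟨hQ | hQ, hQt⟩
    · have := rect_bounds hQ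
      simp [DirectedLine.points, bottomLine, cross, inner_eq_coord] at hQt ⊢; linarith
    · have := rect_bounds' hQ
      simp [DirectedLine.points, bottomLine, cross, inner_eq_coord] at hQt ⊢; linarith
  · intro h
    have := rect_bounds' h
    norm_num at this
  · exact ⟨Or.inr m4, by simp [DirectedLine.points, bottomLine, cross]⟩
  · rintro Q ⟨hQ | hQ, hQt⟩
    · have := rect_bounds hQ
      simp [DirectedLine.points, bottomLine, cross, inner_eq_coord] at hQt ⊢; linarith
    · have := rect_bounds' hQ
      simp [DirectedLine.points, bottomLine, cross, inner_eq_coord] at hQt ⊢; linarith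
  · intro h
    have := rect_bounds h
    norm_num at this
  · exact ⟨_, by simp [DirectedLine.points, topLine, cross], m1⟩
  · intro Q hQ
    have := rect_bounds hQ
    simp [DirectedLine.left, topLine, cross]; linarith
  · exact ⟨_, by simp [DirectedLine.points, topLine, cross], m3⟩
  · intro Q hQ
    have := rect_bounds' hQ
    simp [DirectedLine.left, topLine, cross]; linarith
  · exact ⟨Or.inl m1, by simp [DirectedLine.points, topLine, cross]⟩
  · rintro Q ⟨hQ | hQ, hQt⟩
    · have := rect_bounds hQ
      simp [DirectedLine.points, topLine, cross, inner_eq_coord] at hQt ⊢; linarith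
    · have := rect_bounds' hQ
      simp [DirectedLine.points, topLine, cross, inner_eq_coord] at hQt ⊢; linarith
  · intro h
    have := rect_bounds' h
    norm_num at this
  · exact ⟨Or.inr m3, by simp [DirectedLine.points, topLine, cross]⟩
  · rintro Q ⟨hQ | hQ, hQt⟩
    · have := rect_bounds hQ
      simp [DirectedLine.points, topLine, cross, inner_eq_coord] at hQt ⊢; linarith
    · have := rect_bounds' hQ
      simp [DirectedLine.points, topLine, cross, inner_eq_coord] at hQt ⊢; linarith
  · intro h
    have := rect_bounds h
    norm_num at this

/-- The unshared vertices are (±3, ±4). A vertical line through two of them separates the shared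
vertices (±5, 0); a horizontal one, directed so as to support, meets the first rectangle before the
second. -/
lemma rect_not_newCrosses :
    ¬ NewCrosses (convexHull ℝ rectVertices') (convexHull ℝ rectVertices) := by
  rintro ⟨t, -, -, ht, -⟩
  obtain ⟨⟨P, hP, hPn, hPt⟩, R, hR, hRn, hRt⟩ := ht.exists_vertices
  obtain ⟨hL, hD, ⟨U, hU, hUm⟩, -⟩ := ht
  have hu := t.sq_add_sq
  have hA := hD.2 (subset_convexHull ℝ _ (show !₂[5, 0] ∈ rectVertices by simp [rectVertices]))
  have hC := hD.2 (subset_convexHull ℝ _ (show !₂[-5, 0] ∈ rectVertices by simp [rectVertices]))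
  have hUR := hU.2 R ⟨Or.inr (subset_convexHull ℝ _ hR), hRt⟩
  have hUt := hU.1.2
  have hUb := rect_bounds' hUm.1
  have cA : !₂[5, 0] ∈ convexHull ℝ rectVertices :=
    subset_convexHull ℝ _ (by simp [rectVertices])
  have cC : !₂[-5, 0] ∈ convexHull ℝ rectVertices :=
    subset_convexHull ℝ _ (by simp [rectVertices])
  have cA' : !₂[5, 0] ∈ convexHull ℝ rectVertices' :=
    subset_convexHull ℝ _ (by simp [rectVertices'])
  have cC' : !₂[-5, 0] ∈ convexHull ℝ rectVertices' :=
    subset_convexHull ℝ _ (by simp [rectVertices'])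
  simp only [DirectedLine.left, DirectedLine.points, Set.mem_ofPred_eq, cross, inner_eq_coord]
    at hA hC hPt hRt hUt hUR
  generalize t.dir 0 = p at *
  generalize t.dir 1 = q at *
  rcases hP with rfl | rfl | rfl | rfl
  · exact hPn cA
  · rcases hR with rfl | rfl | rfl | rfl
    · exact hRn cA'
    -- The line is `y = 4` directed to the left: `U` is not after (3, 4), yet the second rectangle
    -- has no point there with abscissa above -3.
    · simp at hA hC hPt hRt hUt hUR
      have hq : q = 0 := by linarith
      subst hq
      have hp : p < 0 := lt_of_le_of_ne (by linarith) (by rintro rfl; norm_num at hu)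
      have h1 : p * (U 1 - 4) = 0 := by linarith
      have h2 := (mul_eq_zero.1 h1).resolve_left hp.ne
      nlinarith
    · exact hRn cC'
    -- The line is `x = -3`, with (5, 0) and (-5, 0) strictly on different sides.
    · simp at hA hC hPt hRt hUt hUR
      have hp : p = 0 := by linarith
      have hq : q = 0 := by subst hp; apply le_antisymm <;> linarith
      subst hp hq; norm_num at hu
  · exact hPn cC
  · rcases hR with rfl | rfl | rfl | rfl
    · exact hRn cA'
    · simp at hA hC hPt hRt hUt hUR
      have hp : p = 0 := by linarith
      have hq : q = 0 := by subst hp; apply le_antisymm <;> linarith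
      subst hp hq; norm_num at hu
    · exact hRn cC'
    · simp at hA hC hPt hRt hUt hUR
      have hq : q = 0 := by linarith
      subst hq
      have hp : 0 < p := lt_of_le_of_ne (by linarith) (by rintro rfl; norm_num at hu)
      have h1 : p * (U 1 + 4) = 0 := by linarith
      have h2 := (mul_eq_zero.1 h1).resolve_left hp.ne'
      nlinarith

/-! ### Old-crossing hexagons that do not weakly new-cross -/

/-- The vertices of a hexagon elongated in the horizontal direction. -/
def hexVertices : Set Plane :=
  {!₂[2, 2], !₂[-2, 2], !₂[-2, -2], !₂[2, -2], !₂[3, 0], !₂[-3, 0]}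

/-- The vertices of the hexagon rotated by a right angle. -/
def hexVertices' : Set Plane :=
  {!₂[2, 2], !₂[-2, 2], !₂[-2, -2], !₂[2, -2], !₂[0, 3], !₂[0, -3]}

lemma hex_isRotatedCopy :
    IsRotatedCopy (convexHull ℝ hexVertices) (convexHull ℝ hexVertices') := by
  refine ⟨0, Real.pi / 2, ?_⟩
  rw [(isLinearMap_rotation_zero _).image_convexHull]
  congr 1
  simp only [hexVertices, hexVertices', Set.image_insert_eq, Set.image_singleton, rotation,
    Real.cos_pi_div_two, Real.sin_pi_div_two]
  norm_num
  ext Q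
  simp only [Set.mem_insert_iff, Set.mem_singleton_iff]
  tauto

/-- No common supporting line of the hexagons contains tips of both of them. -/
lemma hex_tips {t : DirectedLine} (hS : convexHull ℝ hexVertices ⊆ t.left) {P R : Plane}
    (hP : P ∈ hexVertices) (hPn : P ∉ convexHull ℝ hexVertices') (hPt : P ∈ t.points)
    (hR : R ∈ hexVertices') (hRn : R ∉ convexHull ℝ hexVertices) (hRt : R ∈ t.points) :
    False := by
  have hu := t.sq_add_sq
  have m := fun Q (hQ : Q ∈ hexVertices) => hS (subset_convexHull ℝ _ hQ)
  have h1 := m !₂[2, 2] (by simp [hexVertices])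
  have h2 := m !₂[-2, 2] (by simp [hexVertices])
  have h3 := m !₂[-2, -2] (by simp [hexVertices])
  have h4 := m !₂[2, -2] (by simp [hexVertices])
  have hP' : P = !₂[3, 0] ∨ P = !₂[-3, 0] := by
    by_contra! hne
    apply hPn
    apply subset_convexHull ℝ hexVertices'
    simp only [hexVertices, hexVertices', Set.mem_insert_iff, Set.mem_singleton_iff] at hP ⊢
    tauto
  have hR' : R = !₂[0, 3] ∨ R = !₂[0, -3] := by
    by_contra! hne
    apply hRn
    apply subset_convexHull ℝ hexVertices
    simp only [hexVertices, hexVertices', Set.mem_insert_iff, Set.mem_singleton_iff] at hR ⊢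
    tauto
  simp only [DirectedLine.left, DirectedLine.points, Set.mem_ofPred_eq, cross]
    at h1 h2 h3 h4 hPt hRt
  generalize t.dir 0 = p at *
  generalize t.dir 1 = q at *
  -- A line through tips of both hexagons, such as `x + y = 3`, strictly separates two opposite
  -- corners of the common square, so no nonzero direction is possible.
  have : p = 0 ∧ q = 0 := by
    rcases hP' with rfl | rfl <;> rcases hR' with rfl | rfl <;>
      simp at h1 h2 h3 h4 hPt hRt <;> constructor <;> linarith
  obtain ⟨rfl, rfl⟩ := this
  norm_num at hu

lemma hex_not_newCrosses :
    ¬ NewCrosses (convexHull ℝ hexVertices) (convexHull ℝ hexVertices') := by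
  rintro ⟨t, -, -, ht, -⟩
  obtain ⟨⟨P, hP, hPn, hPt⟩, R, hR, hRn, hRt⟩ := ht.exists_vertices
  exact hex_tips ht.1.2 hP hPn hPt hR hRn hRt

lemma hex_not_newCrosses' :
    ¬ NewCrosses (convexHull ℝ hexVertices') (convexHull ℝ hexVertices) := by
  rintro ⟨t, -, -, ht, -⟩
  obtain ⟨⟨P, hP, hPn, hPt⟩, R, hR, hRn, hRt⟩ := ht.exists_vertices
  exact hex_tips ht.2.1.2 hR hRn hRt hP hPn hPt

/-- The segment joining the tips of one hexagon cuts the other: its half-length 3 exceeds the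
half-width 2 of the other hexagon in that direction. -/
lemma hex_oldCrossing : OldCrossing (convexHull ℝ hexVertices) (convexHull ℝ hexVertices') := by
  have b : ∀ Q ∈ convexHull ℝ hexVertices, Q 1 ≤ 2 ∧ -2 ≤ Q 1 := by
    intro Q hQ
    have h1 := le_of_mem_convexHull (p := 0) (q := 1) (c := 2)
      (by norm_num [hexVertices]) hQ
    have h2 := le_of_mem_convexHull (p := 0) (q := -1) (c := 2)
      (by norm_num [hexVertices]) hQ
    constructor <;> linarith
  have b' : ∀ Q ∈ convexHull ℝ hexVertices', Q 0 ≤ 2 ∧ -2 ≤ Q 0 := by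
    intro Q hQ
    have h1 := le_of_mem_convexHull (p := 1) (q := 0) (c := 2)
      (by norm_num [hexVertices']) hQ
    have h2 := le_of_mem_convexHull (p := -1) (q := 0) (c := 2)
      (by norm_num [hexVertices']) hQ
    constructor <;> linarith
  have m := fun Q (hQ : Q ∈ hexVertices) => subset_convexHull ℝ _ hQ
  have m' := fun Q (hQ : Q ∈ hexVertices') => subset_convexHull ℝ _ hQ
  constructor
  · refine Connected.not_of_sign_change (f := fun Q => Q 0) (by fun_prop) ?_
      (A := !₂[-3, 0]) (B := !₂[3, 0]) ?_ ?_ (by simp) (by simp)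
    · rintro Q ⟨hQ, hn⟩ h0
      have hb := b Q hQ
      apply hn
      have := convex_convexHull ℝ hexVertices' (m' !₂[0, 3] (by simp [hexVertices']))
        (m' !₂[0, -3] (by simp [hexVertices']))
        (show 0 ≤ (3 + Q 1) / 6 by linarith) (show 0 ≤ (3 - Q 1) / 6 by linarith) (by ring)
      convert this
      ext i
      fin_cases i
      · simpa using h0
      · simp; ring
    · exact ⟨m _ (by simp [hexVertices]), fun h => by have := b' _ h; norm_num at this⟩
    · exact ⟨m _ (by simp [hexVertices]), fun h => by have := b' _ h; norm_num at this⟩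
  · refine Connected.not_of_sign_change (f := fun Q => Q 1) (by fun_prop) ?_
      (A := !₂[0, -3]) (B := !₂[0, 3]) ?_ ?_ (by simp) (by simp)
    · rintro Q ⟨hQ, hn⟩ h0
      have hb := b' Q hQ
      apply hn
      have := convex_convexHull ℝ hexVertices (m !₂[3, 0] (by simp [hexVertices]))
        (m !₂[-3, 0] (by simp [hexVertices]))
        (show 0 ≤ (3 + Q 0) / 6 by linarith) (show 0 ≤ (3 - Q 0) / 6 by linarith) (by ring)
      convert this
      ext i
      fin_cases i
      · simp; ring
      · simpa using h0
    · exact ⟨m' _ (by simp [hexVertices']), fun h => by have := b _ h; norm_num at this⟩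
    · exact ⟨m' _ (by simp [hexVertices']), fun h => by have := b _ h; norm_num at this⟩

/-! ### The order on the five concepts -/

lemma not_impliesRot_forward_backward : ¬ ImpliesRot .forward .backward := fun h =>
  rect_not_newCrosses (h (polygon rectVertices (by simp [rectVertices]) (by simp [rectVertices]))
    (polygon rectVertices' (by simp [rectVertices']) (by simp [rectVertices']))
    rect_isRotatedCopy rect_newCrosses)

lemma not_impliesRot_backward_forward : ¬ ImpliesRot .backward .forward := fun h =>
  rect_not_newCrosses (h
    (polygon rectVertices' (by simp [rectVertices']) (by simp [rectVertices']))
    (polygon rectVertices (by simp [rectVertices]) (by simp [rectVertices]))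
    rect_isRotatedCopy.symm rect_newCrosses)

lemma not_impliesRot_old_weak : ¬ ImpliesRot .old .weak := fun h =>
  (h (polygon hexVertices (by simp [hexVertices]) (by simp [hexVertices]))
    (polygon hexVertices' (by simp [hexVertices']) (by simp [hexVertices']))
    hex_isRotatedCopy hex_oldCrossing).elim hex_not_newCrosses hex_not_newCrosses'

lemma Implies.refl (u : Concept) : Implies u u := fun _ _ h => h

lemma Implies.trans {u v w : Concept} (h : Implies u v) (h' : Implies v w) : Implies u w :=
  fun D L hu => h' D L (h D L hu)

lemma Implies.impliesRot {u v : Concept} (h : Implies u v) : ImpliesRot u v :=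
  fun D L _ hu => h D L hu

lemma ImpliesRot.trans {u v w : Concept} (h : ImpliesRot u v) (h' : ImpliesRot v w) :
    ImpliesRot u w :=
  fun D L hr hu => h' D L hr (h D L hr hu)

lemma HasseEdge.implies {u v : Concept} (h : HasseEdge u v) : Implies u v := by
  cases h with
  | strong_forward => exact fun _ _ h => h.1
  | strong_backward => exact fun _ _ h => h.2
  | forward_weak => exact fun _ _ h => Or.inl h
  | backward_weak => exact fun _ _ h => Or.inr h
  | weak_old =>
    rintro D L (h | h)
    · exact h.oldCrossing D.convex L.convex
    · exact (h.oldCrossing L.convex D.convex).symm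

/-- The order of the diagram, as a table. -/
def DiagramLE : Concept → Concept → Prop
  | .strong, _ => True
  | .forward, v => v = .forward ∨ v = .weak ∨ v = .old
  | .backward, v => v = .backward ∨ v = .weak ∨ v = .old
  | .weak, v => v = .weak ∨ v = .old
  | .old, v => v = .old

lemma DiagramLE.reflTransGen {u v : Concept} (h : DiagramLE u v) :
    Relation.ReflTransGen HasseEdge u v := by
  have sf := Relation.ReflTransGen.single HasseEdge.strong_forward
  have sb := Relation.ReflTransGen.single HasseEdge.strong_backward
  have fw := Relation.ReflTransGen.single HasseEdge.forward_weak
  have bw := Relation.ReflTransGen.single HasseEdge.backward_weak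
  have wo := Relation.ReflTransGen.single HasseEdge.weak_old
  cases u <;> cases v <;> first
    | exact Relation.ReflTransGen.refl
    | assumption
    | exact sf.trans fw
    | exact fw.trans wo
    | exact bw.trans wo
    | exact (sf.trans fw).trans wo
    | simp [DiagramLE] at h

lemma implies_of_reflTransGen {u v : Concept} (h : Relation.ReflTransGen HasseEdge u v) :
    Implies u v := by
  induction h with
  | refl => exact Implies.refl u
  | tail _ e ih => exact ih.trans e.implies

/-- Any implication absent from the table, composed with edges of the diagram, would yield one of
the three refuted ones. -/
lemma ImpliesRot.diagramLE {u v : Concept} (h : ImpliesRot u v) : DiagramLE u v := by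
  have sf := HasseEdge.strong_forward.implies.impliesRot
  have sb := HasseEdge.strong_backward.implies.impliesRot
  have fw := HasseEdge.forward_weak.implies.impliesRot
  have bw := HasseEdge.backward_weak.implies.impliesRot
  have n1 := not_impliesRot_forward_backward
  have n2 := not_impliesRot_backward_forward
  have n3 := not_impliesRot_old_weak
  cases u <;> cases v <;> first
    | (simp [DiagramLE]; done)
    | exact absurd h ‹_›
    | exact absurd (h.trans sb) n1
    | exact absurd (h.trans sf) n2
    | exact absurd (bw.trans h) n2
    | exact absurd (fw.trans h) n1
    | exact absurd (bw.trans (h.trans sf)) n2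
    | exact absurd (h.trans fw) n3
    | exact absurd (h.trans bw) n3
    | exact absurd (h.trans (sf.trans fw)) n3

/-- The relations form a cycle of inclusions: table, closure of the edges, `Implies`, `ImpliesRot`,
table. -/
lemma implies_eq_diagramLE : Implies = DiagramLE := by
  ext u v
  exact ⟨fun h => h.impliesRot.diagramLE, fun h => implies_of_reflTransGen h.reflTransGen⟩

lemma impliesRot_eq_diagramLE : ImpliesRot = DiagramLE := by
  ext u v
  exact ⟨fun h => h.diagramLE, fun h => (implies_of_reflTransGen h.reflTransGen).impliesRot⟩

lemma isPartialOrder_diagramLE : IsPartialOrder Concept DiagramLE where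
  refl u := by cases u <;> simp [DiagramLE]
  trans u v w := by cases u <;> cases v <;> simp +contextual [DiagramLE]
  antisymm u v := by cases u <;> cases v <;> simp [DiagramLE]

lemma covers_diagramLE_iff (u v : Concept) : Covers DiagramLE u v ↔ HasseEdge u v := by
  constructor
  · rintro ⟨h, hne, hc⟩
    -- These two intermediate concepts suffice to refute every comparable pair that is not an edge.
    have hf := hc .forward
    have hw := hc .weak
    cases u <;> cases v <;> first
      | constructor
      | (simp [DiagramLE] at h; done)
      | (simp at hne; done)
      | (simp [DiagramLE] at hf hw)
  · intro h
    refine ⟨?_, ?_, fun c => ?_⟩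
    · cases h <;> simp [DiagramLE]
    · cases h <;> simp
    · cases h <;> cases c <;> simp [DiagramLE]

end CrossingHierarchy

theorem theorem3 :
    IsPartialOrder CrossingHierarchy.Concept CrossingHierarchy.Implies ∧
    IsPartialOrder CrossingHierarchy.Concept CrossingHierarchy.ImpliesRot ∧
    (∀ u v : CrossingHierarchy.Concept,
      CrossingHierarchy.Implies u v ↔ CrossingHierarchy.ImpliesRot u v) ∧
    (∀ u v : CrossingHierarchy.Concept,
      CrossingHierarchy.Covers CrossingHierarchy.Implies u v ↔
        CrossingHierarchy.HasseEdge u v) ∧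
    (∀ u v : CrossingHierarchy.Concept,
      CrossingHierarchy.Covers CrossingHierarchy.ImpliesRot u v ↔
        CrossingHierarchy.HasseEdge u v) ∧
    (∀ u v : CrossingHierarchy.Concept,
      CrossingHierarchy.Implies u v ↔
        Relation.ReflTransGen CrossingHierarchy.HasseEdge u v) := by
  open CrossingHierarchy in
  refine ⟨implies_eq_diagramLE ▸ isPartialOrder_diagramLE,
    impliesRot_eq_diagramLE ▸ isPartialOrder_diagramLE, fun u v => ?_, fun u v => ?_,
    fun u v => ?_, fun u v => ⟨fun h => h.impliesRot.diagramLE.reflTransGen,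
      implies_of_reflTransGen⟩⟩
  · rw [CrossingHierarchy.implies_eq_diagramLE, CrossingHierarchy.impliesRot_eq_diagramLE]
  · rw [CrossingHierarchy.implies_eq_diagramLE, CrossingHierarchy.covers_diagramLE_iff]
  · rw [CrossingHierarchy.impliesRot_eq_diagramLE, CrossingHierarchy.covers_diagramLE_iff]
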